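/- Let $D$ be a division ring with prime subring $Z$ (the subring generated by $1$). Let $(G,<)$ be an ordered group, not necessarily abelian, written additively, i.e. a group with a total order that is invariant under left and right translations. Let $\upsilon\colon D\to G\cup\{\infty\}$ be a nontrivial valuation: $\upsilon(x)=\infty$ iff $x=0$, $\upsilon(x+y)\ge\min\{\upsilon(x),\upsilon(y)\}$, $\upsilon(xy)=\upsilon(x)+\upsilon(y)$, and $\upsilon(x)\neq 0$ for some $x\ne 0$. For $S\subseteq D$ and $g\in G$ put $S_{\ge g}=\{s\in S:\upsilon(s)\ge g\}$ and $S_{>g}=\{s\in S:\upsilon(s)>g\}$; let $D_g=D_{\ge g}/D_{>g}$, let $\mathrm{gr}_\upsilon(D)=\bigoplus_{g\in G}D_g$ be the associated graded ring, with multiplication $(x+D_{>g})(y+D_{>h})=xy+D_{>g+h}$, and let $Z_0=Z_{\ge 0}/Z_{>0}\subseteq D_0$, a central subring of $\mathrm{gr}_\upsilon(D)$. For $g,h\in G$ let $|g|=\max\{g,-g\}$; write $h\gg g$ if $n|g|<|h|$ for all integers $n\ge 1$, and $g\sim h$ if there are integers $m,n\ge 1$ with $|g|<m|h|$ and $|h|<n|g|$.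 (When applied to values of $\upsilon$, these relations include the requirement that both values lie in $G$, i.e. are not $\infty$.) Let $X$ be a subset of $D$, not consisting of exactly one element, such that: 1. the map $X\to\mathrm{gr}_\upsilon(D)$, $x\mapsto x+D_{>\upsilon(x)}$, is injective; 2. $\upsilon(x)>0$ for each $x\in X$; 3. $\upsilon(x)\sim\upsilon(y)$ for all $x,y\in X$; 4. the $Z_0$-subalgebra of $\mathrm{gr}_\upsilon(D)$ generated by $\{x+D_{>\upsilon(x)}\}_{x\in X}$ is the free $Z_0$-algebra on the set $\{x+D_{>\upsilon(x)}\}_{x\in X}$. Then for any central subfield $k$ of $D$ the following hold, where the free group $k$-algebra on a set is the group algebra over $k$ of the free group on that set. (a) If there is no $z\in Z$ such that $\upsilon(z)\gg\upsilon(x)$ for all $x\in X$, then the $k$-subalgebra of $D$ generated by $\{1+x,(1+x)^{-1}\}_{x\in X}$ is the free group $k$-algebra on the set $\{1+x\}_{x\in X}$. (b) If $z\in Z$ satisfies $\upsilon(z)\gg\upsilon(x)$ for all $x\in X$, then the $k$-subalgebra of $D$ generated by $\{1+zx,(1+zx)^{-1}\}_{x\in X}$ is the free group $k$-algebra on the set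 $\{1+zx\}_{x\in X}$. -/

import Mathlib

/-- A valuation on a ring `R` with values in `G ∪ {∞}`, where `G` is an additively written ordered
group that need not be abelian. (Mathlib's `AddValuation` needs a commutative value group.) -/
structure GroupValuation (R : Type*) [Ring R] (G : Type*) [AddGroup G] [LinearOrder G] where
  /-- The underlying map. -/
  toFun : R → WithTop G
  eq_top_iff' : ∀ x, toFun x = ⊤ ↔ x = 0
  min_le_add' : ∀ x y, min (toFun x) (toFun y) ≤ toFun (x + y)
  map_mul' : ∀ x y, toFun (x * y) = toFun x + toFun y

/-- `InfinitelySmall g h` is the relation `g ≪ h` in an ordered group (also written `h ≫ g`):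
`n |g| < |h|` for all positive integers `n`. -/
def InfinitelySmall {G : Type*} [AddGroup G] [LinearOrder G] (g h : G) : Prop :=
  ∀ n : ℕ, 0 < n → n • |g| < |h|

/-- `ArchEquiv g h` is Archimedean equivalence `g ∼ h` in an ordered group. -/
def ArchEquiv {G : Type*} [AddGroup G] [LinearOrder G] (g h : G) : Prop :=
  ∃ m n : ℕ, 0 < m ∧ 0 < n ∧ |g| < m • |h| ∧ |h| < n • |g|

namespace GroupValuation

section

variable {R : Type*} [Ring R] {G : Type*} [AddGroup G] [LinearOrder G]

instance : CoeFun (GroupValuation R G) (fun _ => R → WithTop G) := ⟨toFun⟩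

/-- The valuation is nontrivial: it is not identically `0` on `R \ {0}`. -/
def IsNontrivial (v : GroupValuation R G) : Prop := ∃ x : R, x ≠ 0 ∧ v x ≠ 0

/-- `v(x) ≪ v(y)`, as elements of `G` (so both values are finite). -/
def ValueLL (v : GroupValuation R G) (x y : R) : Prop :=
  ∃ g h : G, v x = g ∧ v y = h ∧ InfinitelySmall g h

/-- `v(x) ∼ v(y)`, as elements of `G` (so both values are finite). -/
def ValueArchEquiv (v : GroupValuation R G) (x y : R) : Prop :=
  ∃ g h : G, v x = g ∧ v y = h ∧ ArchEquiv g h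

theorem map_zero (v : GroupValuation R G) : v 0 = ⊤ := (v.eq_top_iff' 0).2 rfl

end

section

variable {R : Type*} [Ring R] [Nontrivial R]
  {G : Type*} [AddGroup G] [LinearOrder G] [AddLeftMono G] [AddRightMono G]
  (v : GroupValuation R G)

set_option linter.unusedSectionVars false in
theorem map_one : v 1 = 0 := by
  have h := v.map_mul' 1 1
  rw [one_mul] at h
  have h1 : v 1 ≠ ⊤ := fun e => one_ne_zero ((v.eq_top_iff' 1).1 e)
  obtain ⟨g, hg⟩ := WithTop.ne_top_iff_exists.1 h1
  rw [← hg, ← WithTop.coe_add, WithTop.coe_inj] at h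
  rw [← hg, left_eq_add.1 h, WithTop.coe_zero]

theorem map_neg_one : v (-1) = 0 := by
  have h := v.map_mul' (-1) (-1)
  rw [neg_mul_neg, one_mul, v.map_one] at h
  have h1 : v (-1) ≠ ⊤ := fun e => neg_ne_zero.2 one_ne_zero ((v.eq_top_iff' (-1)).1 e)
  obtain ⟨g, hg⟩ := WithTop.ne_top_iff_exists.1 h1
  rw [← hg, ← WithTop.coe_add, ← WithTop.coe_zero, WithTop.coe_inj] at h
  rw [← hg, ← WithTop.coe_zero, WithTop.coe_inj]
  rcases lt_trichotomy g 0 with h0 | h0 | h0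
  · exact absurd h.symm (add_neg h0 h0).ne
  · exact h0
  · exact absurd h (add_pos h0 h0).ne

theorem map_neg (x : R) : v (-x) = v x := by
  rw [← neg_one_mul, v.map_mul', v.map_neg_one, zero_add]

/-- `R_{≥ g}`. -/
def geSubgroup (g : G) : AddSubgroup R where
  carrier := {x | (g : WithTop G) ≤ v x}
  zero_mem' := by simp [v.map_zero]
  add_mem' {x y} hx hy := (le_min hx hy).trans (v.min_le_add' x y)
  neg_mem' {x} hx := by simpa [v.map_neg] using hx

/-- `R_{> g}`. -/
def gtSubgroup (g : G) : AddSubgroup R where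
  carrier := {x | (g : WithTop G) < v x}
  zero_mem' := by simp [v.map_zero]
  add_mem' {x y} hx hy := (lt_min hx hy).trans_le (v.min_le_add' x y)
  neg_mem' {x} hx := by simpa [v.map_neg] using hx

theorem mul_mem_ge {g h : G} {x y : R} (hx : x ∈ v.geSubgroup g) (hy : y ∈ v.geSubgroup h) :
    x * y ∈ v.geSubgroup (g + h) := by
  change ((g + h : G) : WithTop G) ≤ v (x * y)
  rw [v.map_mul', WithTop.coe_add]
  exact add_le_add hx hy

theorem mul_mem_gt_left {g h : G} {x y : R} (hx : x ∈ v.gtSubgroup g)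
    (hy : y ∈ v.geSubgroup h) : x * y ∈ v.gtSubgroup (g + h) := by
  change ((g + h : G) : WithTop G) < v (x * y)
  change (g : WithTop G) < v x at hx
  change (h : WithTop G) ≤ v y at hy
  rw [v.map_mul']
  induction hvx : v x using WithTop.recTopCoe with
  | top => rw [WithTop.top_add]; exact WithTop.coe_lt_top _
  | coe a =>
    induction hvy : v y using WithTop.recTopCoe with
    | top => rw [WithTop.add_top]; exact WithTop.coe_lt_top _
    | coe b =>
      rw [hvx, WithTop.coe_lt_coe] at hx
      rw [hvy, WithTop.coe_le_coe] at hy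
      rw [← WithTop.coe_add, WithTop.coe_lt_coe]
      exact add_lt_add_of_lt_of_le hx hy

theorem mul_mem_gt_right {g h : G} {x y : R} (hx : x ∈ v.geSubgroup g)
    (hy : y ∈ v.gtSubgroup h) : x * y ∈ v.gtSubgroup (g + h) := by
  change ((g + h : G) : WithTop G) < v (x * y)
  change (g : WithTop G) ≤ v x at hx
  change (h : WithTop G) < v y at hy
  rw [v.map_mul']
  induction hvx : v x using WithTop.recTopCoe with
  | top => rw [WithTop.top_add]; exact WithTop.coe_lt_top _
  | coe a =>
    induction hvy : v y using WithTop.recTopCoe with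
    | top => rw [WithTop.add_top]; exact WithTop.coe_lt_top _
    | coe b =>
      rw [hvx, WithTop.coe_le_coe] at hx
      rw [hvy, WithTop.coe_lt_coe] at hy
      rw [← WithTop.coe_add, WithTop.coe_lt_coe]
      exact add_lt_add_of_le_of_lt hx hy

/-- The homogeneous component `R_g = R_{≥ g} / R_{> g}`. -/
abbrev Piece (g : G) : Type _ :=
  v.geSubgroup g ⧸ (v.gtSubgroup g).addSubgroupOf (v.geSubgroup g)

/-- The class `x + R_{> g}` in `R_g` of an element `x` of `R_{≥ g}`. -/
def toPiece (g : G) : v.geSubgroup g →+ v.Piece g :=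
  QuotientAddGroup.mk' _

theorem toPiece_eq_zero {g : G} (x : v.geSubgroup g) (h : (x : R) ∈ v.gtSubgroup g) :
    v.toPiece g x = 0 :=
  (QuotientAddGroup.eq_zero_iff x).2 h

/-- The multiplication `(x + R_{> g}) (y + R_{> h}) = x y + R_{> g + h}`. -/
def pieceMul (g h : G) : v.Piece g →+ v.Piece h →+ v.Piece (g + h) :=
  QuotientAddGroup.lift _
    (AddMonoidHom.mk'
      (fun x : v.geSubgroup g =>
        QuotientAddGroup.lift _
          (AddMonoidHom.mk'
            (fun y : v.geSubgroup h =>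
              v.toPiece (g + h) ⟨(x : R) * (y : R), v.mul_mem_ge x.2 y.2⟩)
            (fun y y' => by
              rw [← _root_.map_add]; congr 1; exact Subtype.ext (mul_add _ _ _)))
          (fun y hy => v.toPiece_eq_zero _ (v.mul_mem_gt_right x.2 hy)))
      (fun x x' => by
        ext y
        change v.toPiece _ _ = v.toPiece _ _ + v.toPiece _ _
        rw [← _root_.map_add]; congr 1; exact Subtype.ext (add_mul _ _ _)))
    (fun x hx => by
      ext y
      exact v.toPiece_eq_zero _ (v.mul_mem_gt_left hx y.2))

theorem toPiece_surjective (g : G) : Function.Surjective (v.toPiece g) :=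
  QuotientAddGroup.mk'_surjective _

theorem one_mem_ge : (1 : R) ∈ v.geSubgroup 0 := by
  change ((0 : G) : WithTop G) ≤ v 1
  rw [v.map_one]; rfl

theorem sigma_toPiece_ext {g h : G} (x : v.geSubgroup g) (y : v.geSubgroup h)
    (hgh : g = h) (hxy : (x : R) = y) :
    (⟨g, v.toPiece g x⟩ : GradedMonoid v.Piece) = ⟨h, v.toPiece h y⟩ := by
  subst hgh
  rw [Subtype.ext hxy]

instance instGMul : GradedMonoid.GMul v.Piece where
  mul {g h} a b := v.pieceMul g h a b

instance instGOne : GradedMonoid.GOne v.Piece where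
  one := v.toPiece 0 ⟨1, v.one_mem_ge⟩

instance instGRing : DirectSum.GRing v.Piece where
  mul_zero {g h} a := _root_.map_zero (v.pieceMul g h a)
  zero_mul {g h} b := by
    change v.pieceMul g h 0 b = 0
    rw [_root_.map_zero, AddMonoidHom.zero_apply]
  mul_add {g h} a b c := _root_.map_add (v.pieceMul g h a) b c
  add_mul {g h} a b c := by
    change v.pieceMul g h (a + b) c = v.pieceMul g h a c + v.pieceMul g h b c
    rw [_root_.map_add, AddMonoidHom.add_apply]
  one_mul := by
    rintro ⟨g, a⟩
    obtain ⟨x, rfl⟩ := v.toPiece_surjective g a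
    exact v.sigma_toPiece_ext _ _ (zero_add g) (one_mul (x : R))
  mul_one := by
    rintro ⟨g, a⟩
    obtain ⟨x, rfl⟩ := v.toPiece_surjective g a
    exact v.sigma_toPiece_ext _ _ (add_zero g) (mul_one (x : R))
  mul_assoc := by
    rintro ⟨g, a⟩ ⟨h, b⟩ ⟨i, c⟩
    obtain ⟨x, rfl⟩ := v.toPiece_surjective g a
    obtain ⟨y, rfl⟩ := v.toPiece_surjective h b
    obtain ⟨z, rfl⟩ := v.toPiece_surjective i c
    exact v.sigma_toPiece_ext _ _ (add_assoc g h i) (mul_assoc (x : R) y z)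
  natCast n := n • v.toPiece 0 ⟨1, v.one_mem_ge⟩
  natCast_zero := zero_nsmul _
  natCast_succ n := succ_nsmul _ n
  intCast n := n • v.toPiece 0 ⟨1, v.one_mem_ge⟩
  intCast_ofNat n := natCast_zsmul _ n
  intCast_negSucc_ofNat n := negSucc_zsmul _ n

/-- The associated graded ring `gr_v(R) = ⨁ g, R_{≥ g} / R_{> g}`. -/
abbrev Gr : Type _ := DirectSum G v.Piece

/-- The homogeneous element `x + R_{> g}` of `gr_v(R)`, for `x` in `R_{≥ g}`. -/
noncomputable def homog (g : G) (x : v.geSubgroup g) : v.Gr :=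
  DirectSum.of v.Piece g (v.toPiece g x)

theorem homog_mul (g h : G) (x : v.geSubgroup g) (y : v.geSubgroup h) :
    v.homog g x * v.homog h y = v.homog (g + h) ⟨(x : R) * y, v.mul_mem_ge x.2 y.2⟩ :=
  DirectSum.of_mul_of _ _

theorem homog_congr {g h : G} (x : v.geSubgroup g) (y : v.geSubgroup h)
    (hgh : g = h) (hxy : (x : R) = y) : v.homog g x = v.homog h y :=
  DirectSum.of_eq_of_gradedMonoid_eq (v.sigma_toPiece_ext x y hgh hxy)

open Classical in
/-- The leading term `x + R_{> v(x)}` of `x` in `gr_v(R)` (and `0` for `x = 0`). -/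
noncomputable def leadingTerm (x : R) : v.Gr :=
  if hx : x = 0 then 0
  else v.homog ((v x).untop fun h => hx ((v.eq_top_iff' x).1 h))
    ⟨x, show ((_ : G) : WithTop G) ≤ v x from (WithTop.coe_untop _ _).le⟩

/-- The subring `R_{≥ 0}` of `R`. -/
def integerRing : Subring R where
  __ := v.geSubgroup 0
  one_mem' := v.one_mem_ge
  mul_mem' {x y} hx hy := by
    have h := v.mul_mem_ge (g := 0) (h := 0) hx hy
    rwa [add_zero] at h

/-- The ring homomorphism `x ↦ x + R_{> 0}` from `R_{≥ 0}` to `R_0 ⊆ gr_v(R)`. -/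
noncomputable def residue : v.integerRing →+* v.Gr where
  toFun x := v.homog 0 ⟨x, x.2⟩
  map_one' := rfl
  map_mul' x y := by
    rw [homog_mul]
    exact v.homog_congr _ _ (add_zero 0).symm rfl
  map_zero' := by
    change DirectSum.of v.Piece 0 (v.toPiece 0 0) = 0
    rw [_root_.map_zero, _root_.map_zero]
  map_add' x y := by
    change DirectSum.of v.Piece 0 (v.toPiece 0 (⟨x, x.2⟩ + ⟨y, y.2⟩)) = _
    rw [_root_.map_add, _root_.map_add]
    rfl

/-- The subring `Z_0 = Z_{≥ 0} / Z_{> 0}` of `R_0 ⊆ gr_v(R)`, where `Z = ⊥` is the prime subring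
of `R` (the subring generated by `1`): the set of all `z + R_{> 0}` with `z ∈ Z`, `v(z) ≥ 0`. -/
noncomputable def Z0 : Subring v.Gr :=
  ((⊥ : Subring R).comap v.integerRing.subtype).map v.residue

theorem Z0_central (r : v.Gr) (hr : r ∈ v.Z0) (a : v.Gr) : r * a = a * r := by
  obtain ⟨z, hz, rfl⟩ := Subring.mem_map.1 hr
  obtain ⟨n, hn⟩ := Subring.mem_bot.1 (Subring.mem_comap.1 hz)
  induction a using DirectSum.induction_on with
  | zero => rw [mul_zero, zero_mul]
  | add a b ha hb => rw [mul_add, add_mul, ha, hb]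
  | of g b =>
    obtain ⟨x, rfl⟩ := v.toPiece_surjective g b
    change v.homog 0 ⟨z, z.2⟩ * v.homog g x = v.homog g x * v.homog 0 ⟨z, z.2⟩
    rw [homog_mul, homog_mul]
    refine v.homog_congr _ _ (by rw [zero_add, add_zero]) ?_
    change (z : R) * x = x * z
    have hn' : (z : R) = (n : R) := hn.symm
    rw [hn']
    exact Int.cast_commute n (x : R)

noncomputable instance instCommRingZ0 : CommRing v.Z0 where
  mul_comm a b := Subtype.ext (v.Z0_central a a.2 b)

noncomputable instance instAlgebraZ0 : Algebra v.Z0 v.Gr where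
  algebraMap := v.Z0.subtype
  commutes' r a := v.Z0_central r r.2 a
  smul_def' _ _ := rfl

end

end GroupValuation

/-- The `k`-subalgebra of `A` generated by `S` is the free `k`-algebra on the set `S`. -/
def GeneratesFreeAlgebra (k : Type*) [CommRing k] {A : Type*} [Ring A] [Algebra k A]
    (S : Set A) : Prop :=
  ∃ e : FreeAlgebra k S ≃ₐ[k] Algebra.adjoin k S,
    ∀ s : S, (e (FreeAlgebra.ι k s) : A) = s

/-- The `k`-subalgebra of the division ring `D` generated by `{s, s⁻¹}`, `s ∈ S`, is the free group
`k`-algebra on the set `S`, i.e. the group algebra over `k` of the free group on `S`. -/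
def GeneratesFreeGroupAlgebra (k : Type*) [Field k] {D : Type*} [DivisionRing D] [Algebra k D]
    (S : Set D) : Prop :=
  ∃ e : MonoidAlgebra k (FreeGroup S) ≃ₐ[k] Algebra.adjoin k (S ∪ (fun s => s⁻¹) '' S),
    ∀ s : S, (e (MonoidAlgebra.of k (FreeGroup S) (FreeGroup.of s)) : D) = s

-- Since the leading terms of distinct words in `X` are independent, elements of `D` with those
-- leading terms should be independent as well. Such elements exist in the span of the free group:
-- with `y = x` or `y = z x`, the elements `y² (1 + y)⁻¹ = (1 + y) - 2 + (1 + y)⁻¹` and `y (1 + y)⁻¹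
-- = 1 - (1 + y)⁻¹` have the leading terms of `y²` and `y`. Products of them, one factor per letter,
-- attach to each reduced group word a monoid word that determines it
-- (`IsReduced.blockWord_injective`). The products attached to a ball of the free group lie in the
-- span of the image of that ball, so their independence forces that of the image by counting
-- dimensions (`linearIndependent_freeGroup`).
--
-- The difficulty is independence over `k`, since freeness is assumed only over `Z_0`. Coefficients
-- are enlarged twice by one device, `central_combination_ne_zero`: a relation `∑ c_i a_i = 0` with
-- central `c_i` yields the shorter relation `∑ c_i (a_i ρ a_o - a_o ρ a_i) = 0`, and a suitable
-- word behind `ρ` keeps all the words involved distinct. In the graded ring, with `c_i` the leading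
-- terms of powers of an integer `π`, this gives integer coefficients of any value
-- (`wordsIndependent_of_generatesFreeAlgebra`). A minimal value argument carries this to `D`, and
-- clearing denominators gives the prime field. With `c_i` in `k` independent over the prime field,
-- the device then gives `k` (`linearIndependent_perturbedWords`). A single letter must be excluded:
-- if `X = {x}` with `x` in `k`, the subalgebra is only `k`. Replacing `x` by `z x` multiplies words
-- by integers, so (b) follows as (a) does.

universe u

/-! ### Separating words and elimination of central coefficients -/

/-- In a free monoid on two letters or more (or none), every finite set of words is separated by
some word `r`: the products `s r t` determine `s` and `t`. -/
theorem FreeMonoid.exists_separating {ι : Type*} (hι : IsEmpty ι ∨ Nontrivial ι)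
    (S : Finset (FreeMonoid ι)) :
    ∃ r : FreeMonoid ι, ∀ s ∈ S, ∀ t ∈ S, ∀ s' ∈ S, ∀ t' ∈ S,
      s * r * t = s' * r * t' → s = s' ∧ t = t' := by
  rcases hι with hι | ⟨x, y, hxy⟩
  · have : Subsingleton (FreeMonoid ι) := inferInstanceAs (Subsingleton (List ι))
    exact ⟨1, fun _ _ _ _ _ _ _ _ _ => ⟨Subsingleton.elim _ _, Subsingleton.elim _ _⟩⟩
  -- The separating word is `x ^ N y`, with `N` bounding the lengths in `S`. If two occurrences of
  -- it were shifted by `u` with `0 < |u| ≤ N`, then position `N`, counted from the start of the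
  -- first, would hold both `y` and `x`.
  set N := S.sup FreeMonoid.length
  have key : ∀ s t s' t' u : List ι, u.length ≤ N → s' = s ++ u →
      List.replicate N x ++ (y :: t) = u ++ (List.replicate N x ++ (y :: t')) →
      s = s' ∧ t = t' := by
    intro s t s' t' u hu hs h
    rcases Nat.eq_zero_or_pos u.length with h0 | h0
    · rw [List.length_eq_zero_iff] at h0
      subst h0
      simp only [List.nil_append, List.append_cancel_left_eq, List.cons.injEq, true_and] at h
      exact ⟨by simp [hs], h⟩
    · have h' := congrArg (fun l => l[N]?) h
      have h1 : (List.replicate N x ++ (y :: t))[N]? = some y := by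
        rw [List.getElem?_append_right (by simp)]; simp
      have h2 : (u ++ (List.replicate N x ++ (y :: t')))[N]? = some x := by
        rw [List.getElem?_append_right hu, List.getElem?_append_left (by simp; omega)]
        rw [List.getElem?_replicate, if_pos (by omega)]
      simp only [h1, h2, Option.some.injEq] at h'
      exact absurd h'.symm hxy
  refine ⟨FreeMonoid.ofList (List.replicate N x ++ [y]), ?_⟩
  intro s hs t ht s' hs' t' ht' h
  have hs1 : (FreeMonoid.toList s).length ≤ N := Finset.le_sup (f := FreeMonoid.length) hs
  have hs2 : (FreeMonoid.toList s').length ≤ N := Finset.le_sup (f := FreeMonoid.length) hs'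
  have h3 : FreeMonoid.toList s ++ (List.replicate N x ++ (y :: FreeMonoid.toList t)) =
      FreeMonoid.toList s' ++ (List.replicate N x ++ (y :: FreeMonoid.toList t')) := by
    have := congrArg FreeMonoid.toList h
    simpa [FreeMonoid.toList_mul] using this
  have conc : FreeMonoid.toList s = FreeMonoid.toList s' ∧
      FreeMonoid.toList t = FreeMonoid.toList t' := by
    rcases List.append_eq_append_iff.1 h3 with ⟨u, hu1, hu2⟩ | ⟨u, hu1, hu2⟩
    · exact key _ _ _ _ u (by rw [hu1, List.length_append] at hs2; omega) hu1 hu2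
    · obtain ⟨e1, e2⟩ := key _ _ _ _ u (by rw [hu1, List.length_append] at hs1; omega) hu1 hu2
      exact ⟨e1.symm, e2.symm⟩
  exact ⟨FreeMonoid.toList.injective conc.1, FreeMonoid.toList.injective conc.2⟩

/-- Let `P` be a multiplicatively closed relation between words and elements of a `Z`-algebra `R`,
such that elements related to distinct words are `Z`-linearly independent. Then a combination of
elements `∑ j, α i j • b j`, in echelon form, with central regular coefficients `c i` is nonzero. -/
theorem central_combination_ne_zero {ι : Type u} {Z R τ : Type*} [CommRing Z] [NoZeroDivisors Z]
    [Ring R] [Algebra Z R] (hι : IsEmpty ι ∨ Nontrivial ι) (P : Submonoid (FreeMonoid ι × R))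
    (hP : ∀ w, ∃ b, (w, b) ∈ P)
    (hind : ∀ (J : Type u) [Fintype J] (ω : J → FreeMonoid ι) (b : J → R),
      Function.Injective ω → (∀ j, (ω j, b j) ∈ P) → LinearIndependent Z b)
    (c : τ → R) (hc : ∀ i r, c i * r = r * c i) (hreg : ∀ i r, c i * r = 0 → r = 0) (n : ℕ) :
    ∀ (T : Finset τ), T.card = n + 1 → ∀ (J : Type u) [Fintype J] (ω : J → FreeMonoid ι)
      (b : J → R), Function.Injective ω → (∀ j, (ω j, b j) ∈ P) → ∀ (α : τ → J → Z) (p : τ → J),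
      (∀ i ∈ T, α i (p i) ≠ 0) → (∀ i ∈ T, ∀ l ∈ T, i ≠ l → α l (p i) = 0) →
      ∑ i ∈ T, c i * ∑ j, α i j • b j ≠ 0 := by
  classical
  induction n with
  | zero =>
    intro T hT J _ ω b hω hb α p hp _ h
    obtain ⟨i, rfl⟩ := Finset.card_eq_one.1 hT
    rw [Finset.sum_singleton] at h
    exact hp i (Finset.mem_singleton_self i)
      (Fintype.linearIndependent_iff.1 (hind J ω b hω hb) _ (hreg i _ h) (p i))
  | succ n ih =>
    intro T hT J _ ω b hω hb α p hp hp' h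
    obtain ⟨o, ho⟩ : T.Nonempty := by rw [← Finset.card_pos]; omega
    obtain ⟨r, hr⟩ := FreeMonoid.exists_separating hι (Finset.univ.image ω)
    obtain ⟨ρ, hρ⟩ := hP r
    set a : τ → R := fun i => ∑ j, α i j • b j with ha
    have hmul : ∀ i l, a i * ρ * a l = ∑ q : J × J, (α i q.1 * α l q.2) • (b q.1 * ρ * b q.2) := by
      intro i l
      simp only [ha, Finset.sum_mul, Finset.mul_sum, Fintype.sum_prod_type]
      rw [Finset.sum_comm]
      refine Finset.sum_congr rfl fun j _ => Finset.sum_congr rfl fun j' _ => ?_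
      simp only [smul_mul_assoc, mul_smul_comm, smul_smul, mul_comm]
    have hmul' : ∀ i l, a l * ρ * a i =
        ∑ q : J × J, (α l q.1 * α i q.2) • (b q.1 * ρ * b q.2) := fun i l => hmul l i
    -- The induction hypothesis is applied to the elements `a i * ρ * a o - a o * ρ * a i`, which
    -- vanish for `i = o`. Their words `ω s * r * ω t` are distinct because `r` separates. At the
    -- new pivot `(p i, p o)` the product containing `α o (p i) = 0` drops out, so the echelon form
    -- persists.
    refine ih (T.erase o) (by rw [Finset.card_erase_of_mem ho]; omega) (J × J)
      (fun q => ω q.1 * r * ω q.2) (fun q => b q.1 * ρ * b q.2) ?_ ?_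
      (fun i q => α i q.1 * α o q.2 - α o q.1 * α i q.2) (fun i => (p i, p o)) ?_ ?_ ?_
    · rintro ⟨s, t⟩ ⟨s', t'⟩ hst
      have := hr (ω s) (by simp) (ω t) (by simp) (ω s') (by simp) (ω t') (by simp) hst
      rw [hω this.1, hω this.2]
    · rintro ⟨s, t⟩
      exact P.mul_mem (P.mul_mem (hb s) hρ) (hb t)
    · intro i hi
      obtain ⟨hio, hi⟩ := Finset.mem_erase.1 hi
      simp only [hp' i hi o ho hio, zero_mul, sub_zero]
      exact mul_ne_zero (hp i hi) (hp o ho)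
    · intro i hi l hl hil
      obtain ⟨hio, hi⟩ := Finset.mem_erase.1 hi
      obtain ⟨hlo, hl⟩ := Finset.mem_erase.1 hl
      simp only [hp' i hi o ho hio, hp' i hi l hl hil, zero_mul, sub_zero]
    · have h1 : ∀ i, c i * ∑ q : J × J, (α i q.1 * α o q.2 - α o q.1 * α i q.2) •
          (b q.1 * ρ * b q.2) = (c i * a i) * (ρ * a o) - a o * ρ * (c i * a i) := by
        intro i
        have h2 : a o * ρ * (c i * a i) = c i * (a o * ρ * a i) := by
          rw [← mul_assoc, ← hc i, mul_assoc]
        rw [h2, mul_assoc, ← mul_sub, ← mul_assoc (a i), hmul, hmul', ← Finset.sum_sub_distrib]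
        simp only [sub_smul]
      simp only [h1]
      have h3 : ∑ i ∈ T.erase o, ((c i * a i) * (ρ * a o) - a o * ρ * (c i * a i)) =
          ∑ i ∈ T, ((c i * a i) * (ρ * a o) - a o * ρ * (c i * a i)) := by
        rw [← Finset.add_sum_erase T _ ho]
        have : c o * a o * (ρ * a o) - a o * ρ * (c o * a o) = 0 := by
          rw [← mul_assoc (a o * ρ), ← hc o]; simp only [mul_assoc, sub_self]
        rw [this, zero_add]
      rw [h3, Finset.sum_sub_distrib, ← Finset.sum_mul, ← Finset.mul_sum]
      simp only [ha]
      rw [h, zero_mul, mul_zero, sub_zero]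

/-! ### Leading terms and integers in the graded ring -/

namespace GroupValuation

variable {D : Type*} [DivisionRing D] {G : Type*} [AddGroup G] [LinearOrder G] [AddLeftMono G]
  [AddRightMono G] (v : GroupValuation D G)

theorem homog_eq_zero_iff {g : G} (x : v.geSubgroup g) :
    v.homog g x = 0 ↔ (g : WithTop G) < v (x : D) := by
  unfold homog
  rw [← _root_.map_zero (DirectSum.of v.Piece g), (DirectSum.of_injective g).eq_iff]
  exact QuotientAddGroup.eq_zero_iff x

theorem homog_sum {g : G} {J : Type*} (s : Finset J) (x : J → v.geSubgroup g) :
    v.homog g (∑ j ∈ s, x j) = ∑ j ∈ s, v.homog g (x j) := by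
  unfold homog
  rw [_root_.map_sum, _root_.map_sum]

theorem leadingTerm_zero : v.leadingTerm 0 = 0 := by
  unfold leadingTerm
  rw [dif_pos rfl]

theorem leadingTerm_eq_homog {g : G} {x : D} (hx : v x = g) :
    v.leadingTerm x = v.homog g ⟨x, hx.ge⟩ := by
  have hx0 : x ≠ 0 := fun h => by
    rw [h, v.map_zero] at hx
    exact WithTop.top_ne_coe hx
  unfold leadingTerm
  rw [dif_neg hx0]
  exact v.homog_congr _ _ (by rw [WithTop.untop_eq_iff, hx]) rfl

set_option linter.unusedSectionVars false in
theorem exists_eq_coe {x : D} (hx : x ≠ 0) : ∃ g : G, v x = g := by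
  obtain ⟨g, hg⟩ := WithTop.ne_top_iff_exists.1 fun h => hx ((v.eq_top_iff' x).1 h)
  exact ⟨g, hg.symm⟩

theorem leadingTerm_mul (x y : D) : v.leadingTerm (x * y) = v.leadingTerm x * v.leadingTerm y := by
  rcases eq_or_ne x 0 with rfl | hx
  · rw [zero_mul, v.leadingTerm_zero, zero_mul]
  rcases eq_or_ne y 0 with rfl | hy
  · rw [mul_zero, v.leadingTerm_zero, mul_zero]
  obtain ⟨g, hg⟩ := v.exists_eq_coe hx
  obtain ⟨h, hh⟩ := v.exists_eq_coe hy
  rw [v.leadingTerm_eq_homog hg, v.leadingTerm_eq_homog hh, homog_mul,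
    v.leadingTerm_eq_homog (g := g + h) (by rw [v.map_mul', hg, hh, WithTop.coe_add])]

theorem leadingTerm_one : v.leadingTerm 1 = 1 := v.leadingTerm_eq_homog v.map_one

/-- The leading term, as a monoid homomorphism. -/
noncomputable def leadingTermHom : D →* v.Gr where
  toFun := v.leadingTerm
  map_one' := v.leadingTerm_one
  map_mul' := v.leadingTerm_mul

/-- This goes beyond centrality of `Z_0`, because an integer of positive value has its leading term
outside degree `0`. -/
theorem leadingTerm_intCast_central (n : ℤ) (a : v.Gr) :
    v.leadingTerm (n : D) * a = a * v.leadingTerm (n : D) := by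
  rcases eq_or_ne (n : D) 0 with h | h
  · rw [h, v.leadingTerm_zero, zero_mul, mul_zero]
  obtain ⟨g, hg⟩ := v.exists_eq_coe h
  induction a using DirectSum.induction_on with
  | zero => rw [mul_zero, zero_mul]
  | add a b ha hb => rw [mul_add, add_mul, ha, hb]
  | of l b =>
    obtain ⟨⟨x, hx⟩, rfl⟩ := v.toPiece_surjective l b
    change _ * v.homog l ⟨x, hx⟩ = v.homog l ⟨x, hx⟩ * _
    by_cases hlx : (l : WithTop G) < v x
    · rw [(v.homog_eq_zero_iff ⟨x, hx⟩).2 hlx, zero_mul, mul_zero]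
    · have hx' : v x = l := le_antisymm (not_lt.1 hlx) hx
      rw [← v.leadingTerm_eq_homog hx', ← leadingTerm_mul, ← leadingTerm_mul,
        Int.cast_commute n x]

theorem natCast_nonneg (n : ℕ) : 0 ≤ v (n : D) := by
  induction n with
  | zero => rw [Nat.cast_zero, v.map_zero]; exact le_top
  | succ n ih =>
    rw [Nat.cast_succ]
    exact (le_min ih v.map_one.ge).trans (v.min_le_add' _ _)

theorem intCast_nonneg (n : ℤ) : 0 ≤ v (n : D) := by
  obtain ⟨m, rfl | rfl⟩ := n.eq_nat_or_neg
  · rw [Int.cast_natCast]; exact v.natCast_nonneg m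
  · rw [Int.cast_neg, v.map_neg, Int.cast_natCast]; exact v.natCast_nonneg m

set_option linter.unusedSectionVars false in
theorem ne_zero_of_map_eq_zero {x : D} (hx : v x = 0) : x ≠ 0 := fun h => by
  rw [h, v.map_zero] at hx
  exact WithTop.top_ne_zero hx

/-- The integers have a uniformizer: an integer `π ≠ 0` such that each nonzero integer is the
product of a power of `π` and an integer of valuation zero. -/
theorem exists_uniformizer : ∃ π : ℤ, (π : D) ≠ 0 ∧ ∀ n : ℤ, (n : D) ≠ 0 →
    ∃ (i : ℕ) (m : ℤ), v (m : D) = 0 ∧ n = π ^ i * m := by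
  classical
  by_cases h : ∀ n : ℤ, (n : D) ≠ 0 → v (n : D) = 0
  · exact ⟨1, by simp, fun n hn => ⟨0, n, h n hn, by simp⟩⟩
  push Not at h
  obtain ⟨n₀, hn₀, hvn₀⟩ := h
  have hex : ∃ p : ℕ, 0 < p ∧ 0 < v (p : D) := by
    refine ⟨n₀.natAbs, Int.natAbs_pos.2 fun h => hn₀ (by rw [h, Int.cast_zero]), ?_⟩
    have hpos := lt_of_le_of_ne (v.intCast_nonneg n₀) hvn₀.symm
    rcases Int.natAbs_eq n₀ with h | h
    · rw [h] at hpos; simpa using hpos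
    · rw [h, Int.cast_neg, v.map_neg] at hpos; simpa using hpos
  obtain ⟨hp, hvp⟩ := Nat.find_spec hex
  -- `p` is the least positive integer of positive value. The remainder modulo `p` of any integer of
  -- positive value again has positive value, so it is `0` by minimality.
  set p := Nat.find hex with hpdef
  have hdvd : ∀ n : ℤ, v (n : D) ≠ 0 → (p : ℤ) ∣ n := by
    intro n hn
    have hpos := lt_of_le_of_ne (v.intCast_nonneg n) hn.symm
    by_contra hnd
    have hr0 : 0 ≤ n % p := Int.emod_nonneg _ (by omega)
    have hrp : n % p < p := Int.emod_lt_of_pos _ (by omega)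
    have hr1 : n % p ≠ 0 := fun h => hnd (Int.dvd_of_emod_eq_zero h)
    have hlt : (n % p).toNat < p := by omega
    refine Nat.find_min hex hlt ⟨by omega, ?_⟩
    have h1 : (((n % p).toNat : ℕ) : D) = n + -(p * (n / p : ℤ)) := by
      have : (((n % p).toNat : ℕ) : ℤ) = n + -(p * (n / p)) := by
        rw [Int.toNat_of_nonneg hr0, Int.emod_def]; ring
      exact_mod_cast congrArg (Int.cast (R := D)) this
    rw [h1]
    refine (lt_min hpos ?_).trans_le (v.min_le_add' _ _)
    rw [v.map_neg, v.map_mul']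
    exact add_pos_of_pos_of_nonneg hvp (v.intCast_nonneg _)
  -- Positive value includes `∞`, so `p = 0` in `D` has to be ruled out: `p` divides `n₀`, which is
  -- nonzero in `D`.
  have hp0 : ((p : ℤ) : D) ≠ 0 := fun h => by
    obtain ⟨m, hm⟩ := hdvd n₀ hvn₀
    exact hn₀ (by rw [hm, Int.cast_mul, h, zero_mul])
  refine ⟨p, hp0, fun n => ?_⟩
  induction hN : n.natAbs using Nat.strong_induction_on generalizing n with
  | _ N ih =>
    intro hn
    by_cases hvn : v (n : D) = 0
    · exact ⟨0, n, hvn, by simp⟩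
    obtain ⟨m, hm⟩ := hdvd n hvn
    have hm0 : (m : D) ≠ 0 := fun h => hn (by rw [hm, Int.cast_mul, h, mul_zero])
    have hp1 : p ≠ 1 := fun h => by
      rw [h, Nat.cast_one, v.map_one] at hvp
      exact lt_irrefl _ hvp
    have hlt : m.natAbs < N := by
      rw [← hN, hm, Int.natAbs_mul, Int.natAbs_natCast]
      have : 0 < m.natAbs := Int.natAbs_pos.2 fun h => hm0 (by rw [h, Int.cast_zero])
      nlinarith [show 2 ≤ p by omega]
    obtain ⟨i, m', hm', e⟩ := ih _ hlt m rfl hm0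
    exact ⟨i + 1, m', hm', by rw [hm, e]; ring⟩

/-- An integer, as an element of `Z_0`. -/
noncomputable def intResidue (n : ℤ) : v.Z0 :=
  ⟨v.residue (n : v.integerRing), Subring.mem_map.2 ⟨n, Subring.mem_comap.2
    (by rw [_root_.map_intCast]; exact intCast_mem _ n), rfl⟩⟩

theorem intResidue_coe_eq_homog (n : ℤ) :
    (v.intResidue n : v.Gr) = v.homog 0 ⟨(n : D), v.intCast_nonneg n⟩ := by
  change v.residue (n : v.integerRing) = _
  exact v.homog_congr _ _ rfl (by simp)

theorem intResidue_coe_eq_leadingTerm {n : ℤ} (hn : v (n : D) = 0) :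
    (v.intResidue n : v.Gr) = v.leadingTerm (n : D) := by
  rw [intResidue_coe_eq_homog, v.leadingTerm_eq_homog (g := 0) (by rw [hn]; rfl)]

theorem intResidue_ne_zero {n : ℤ} (hn : v (n : D) = 0) : v.intResidue n ≠ 0 := by
  intro h
  have h' := congrArg Subtype.val h
  rw [intResidue_coe_eq_homog, ZeroMemClass.coe_zero, homog_eq_zero_iff] at h'
  exact (lt_irrefl _ (h'.trans_eq hn)).elim

theorem eq_intResidue (a : v.Z0) : ∃ n : ℤ, a = v.intResidue n := by
  obtain ⟨a, ha⟩ := a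
  obtain ⟨z, hz, rfl⟩ := Subring.mem_map.1 ha
  obtain ⟨n, hn⟩ := Subring.mem_bot.1 (Subring.mem_comap.1 hz)
  refine ⟨n, Subtype.ext ?_⟩
  rw [intResidue_coe_eq_homog]
  exact v.homog_congr _ _ rfl hn.symm

/-- The residue of an integer vanishes unless its value is `0`, and integers of value `0` are closed
under products. -/
instance noZeroDivisorsZ0 : NoZeroDivisors v.Z0 where
  eq_zero_or_eq_zero_of_mul_eq_zero {a b} h := by
    have hz : ∀ n : ℤ, v (n : D) ≠ 0 → v.intResidue n = 0 := fun n hn => by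
      refine Subtype.ext ?_
      rw [intResidue_coe_eq_homog]
      exact (v.homog_eq_zero_iff _).2 (lt_of_le_of_ne (v.intCast_nonneg n) hn.symm)
    obtain ⟨m, rfl⟩ := v.eq_intResidue a
    obtain ⟨n, rfl⟩ := v.eq_intResidue b
    by_cases hm : v (m : D) = 0
    · by_cases hn : v (n : D) = 0
      · have hmn : v ((m * n : ℤ) : D) = 0 := by rw [Int.cast_mul, v.map_mul', hm, hn, add_zero]
        refine absurd ?_ (v.intResidue_ne_zero hmn)
        refine Subtype.ext ?_
        rw [intResidue_coe_eq_leadingTerm _ hmn, Int.cast_mul, leadingTerm_mul,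
          ← intResidue_coe_eq_leadingTerm _ hm, ← intResidue_coe_eq_leadingTerm _ hn]
        exact congrArg Subtype.val h
      · exact Or.inr (hz n hn)
    · exact Or.inl (hz m hm)

end GroupValuation

/-! ### Independence of words over the integers -/

namespace GroupValuation

variable {D : Type*} [DivisionRing D] {G : Type*} [AddGroup G] [LinearOrder G] [AddLeftMono G]
  [AddRightMono G] (v : GroupValuation D G)

/-- The words in the family `y` have independent leading terms over the integers: sums of
integral multiples of distinct words that all have value `g` have value `g` again. -/
def WordsIndependent {ι : Type u} (y : ι → D) : Prop :=
  ∀ (J : Type u) [Fintype J] (ω : J → FreeMonoid ι), Function.Injective ω →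
    ∀ (s : Finset J), s.Nonempty → ∀ (n : J → ℤ) (g : G),
      (∀ j ∈ s, v (n j * FreeMonoid.lift y (ω j)) = g) →
      ¬ (g : WithTop G) < v (∑ j ∈ s, n j * FreeMonoid.lift y (ω j))

/-- Words form a basis of the free algebra; injectivity of the leading term on `X` allows indexing
them by words in `X` itself. -/
theorem linearIndependent_leadingTerm_words {X : Set D} (h1 : Set.InjOn v.leadingTerm X)
    (h4 : GeneratesFreeAlgebra v.Z0 (v.leadingTerm '' X)) :
    LinearIndependent v.Z0 fun w : FreeMonoid X =>
      v.leadingTermHom (FreeMonoid.lift (Subtype.val : X → D) w) := by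
  obtain ⟨e, he⟩ := h4
  have hb := ((FreeAlgebra.basisFreeMonoid v.Z0 (v.leadingTerm '' X)).linearIndependent.map'
    e.toLinearMap (LinearMap.ker_eq_bot.2 e.injective)).map'
    (Algebra.adjoin v.Z0 (v.leadingTerm '' X)).val.toLinearMap
    (LinearMap.ker_eq_bot.2 Subtype.val_injective)
  let E : X ≃ v.leadingTerm '' X := Equiv.Set.imageOfInjOn _ _ h1
  have hE : Function.Injective (FreeMonoid.map E) := by
    intro a b hab
    exact List.map_injective_iff.2 E.injective hab
  have hcomp := hb.comp _ hE
  let φ : FreeMonoid (v.leadingTerm '' X) →* FreeAlgebra v.Z0 (v.leadingTerm '' X) :=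
    FreeMonoid.lift (FreeAlgebra.ι v.Z0)
  have hφ : ∀ w, FreeAlgebra.basisFreeMonoid v.Z0 (v.leadingTerm '' X) w = φ w := by
    intro w
    simp [FreeAlgebra.basisFreeMonoid, FreeAlgebra.equivMonoidAlgebraFreeMonoid, φ]
  let ψ : FreeAlgebra v.Z0 (v.leadingTerm '' X) →* v.Gr :=
    (((Algebra.adjoin v.Z0 (v.leadingTerm '' X)).val.comp e.toAlgHom : _ →ₐ[v.Z0] v.Gr) : _ →* _)
  have hψ : v.leadingTermHom.comp (FreeMonoid.lift (Subtype.val : X → D)) =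
      (ψ.comp φ).comp (FreeMonoid.map E) := by
    refine FreeMonoid.hom_eq fun x => ?_
    have hx : ψ (FreeAlgebra.ι v.Z0 (E x)) = v.leadingTerm x := he (E x)
    simp [φ, hx]
    rfl
  have hfun : (fun w => v.leadingTermHom (FreeMonoid.lift (Subtype.val : X → D) w)) =
      fun w => ψ (FreeAlgebra.basisFreeMonoid v.Z0 (v.leadingTerm '' X) (FreeMonoid.map E w)) := by
    funext w
    rw [hφ]
    exact DFunLike.congr_fun hψ w
  rw [hfun]
  exact hcomp

/-- Writing `n = π ^ i * m` with `v m = 0`, the leading term of an integer is a central factor, that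
of `π ^ i`, times an element of `Z_0`. Collecting terms by the exponent `i` gives a combination to
which `central_combination_ne_zero` applies. -/
theorem wordsIndependent_of_generatesFreeAlgebra {X : Set D}
    (hX : IsEmpty X ∨ Nontrivial X) (h1 : Set.InjOn v.leadingTerm X)
    (h4 : GeneratesFreeAlgebra v.Z0 (v.leadingTerm '' X)) :
    v.WordsIndependent (Subtype.val : X → D) := by
  classical
  intro J _ ω hω s hs n g hn hlt
  obtain ⟨π, hπ, hfac⟩ := v.exists_uniformizer
  have hLI := v.linearIndependent_leadingTerm_words h1 h4
  set L : FreeMonoid X →* D := FreeMonoid.lift (Subtype.val : X → D)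
  have hn0 : ∀ j ∈ s, (n j : D) ≠ 0 := by
    intro j hj h
    have := hn j hj
    rw [h, zero_mul, v.map_zero] at this
    exact WithTop.top_ne_coe this
  have hfac' : ∀ j, ∃ (i : ℕ) (m : ℤ), j ∈ s → v (m : D) = 0 ∧ n j = π ^ i * m := by
    intro j
    by_cases hj : j ∈ s
    · obtain ⟨i, m, h⟩ := hfac (n j) (hn0 j hj)
      exact ⟨i, m, fun _ => h⟩
    · exact ⟨0, 0, fun h => absurd h hj⟩
  choose d m hdm using hfac'
  obtain ⟨j₀, hj₀⟩ := hs
  have hp : ∀ i, ∃ j, i ∈ s.image d → j ∈ s ∧ d j = i := by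
    intro i
    by_cases hi : i ∈ s.image d
    · obtain ⟨j, hj⟩ := Finset.mem_image.1 hi
      exact ⟨j, fun _ => hj⟩
    · exact ⟨j₀, fun h => absurd h hi⟩
  choose p hp using hp
  have hcard : (s.image d).card = ((s.image d).card - 1) + 1 := by
    have : 0 < (s.image d).card := Finset.card_pos.2 ⟨_, Finset.mem_image_of_mem d hj₀⟩
    omega
  set c : ℕ → v.Gr := fun i => v.leadingTerm ((π ^ i : ℤ) : D) with hc
  -- Each `j` in `s` contributes only to the row `i = d j`, so the rows have disjoint supports and
  -- any `j` with `d j = i` is a pivot for row `i`.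
  refine central_combination_ne_zero (Z := v.Z0) hX (v.leadingTermHom.comp L).mgraph
    (fun w => ⟨_, MonoidHom.mem_mgraph.2 rfl⟩) ?_ c (fun i r => v.leadingTerm_intCast_central _ r)
    ?_ _ (s.image d) hcard J ω (fun j => v.leadingTermHom (L (ω j))) hω
    (fun j => MonoidHom.mem_mgraph.2 rfl)
    (fun i j => if j ∈ s ∧ d j = i then v.intResidue (m j) else 0) p ?_ ?_ ?_
  · intro J' _ ω' b hω' hb
    have : b = fun j => v.leadingTermHom (L (ω' j)) :=
      funext fun j => (MonoidHom.mem_mgraph.1 (hb j)).symm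
    rw [this]
    exact hLI.comp ω' hω'
  -- `c i` is invertible: the leading term of the inverse in `D` is an inverse.
  · intro i r hr
    have h0 : ((π ^ i : ℤ) : D) ≠ 0 := by rw [Int.cast_pow]; exact pow_ne_zero _ hπ
    have : v.leadingTerm (((π ^ i : ℤ) : D)⁻¹) * c i = 1 := by
      rw [hc, ← leadingTerm_mul, inv_mul_cancel₀ h0, leadingTerm_one]
    rw [← one_mul r, ← this, mul_assoc, hr, mul_zero]
  · intro i hi
    rw [if_pos (hp i hi)]
    exact v.intResidue_ne_zero (hdm _ (hp i hi).1).1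
  · intro i hi l _ hil
    rw [if_neg fun h => hil ((hp i hi).2.symm.trans h.2)]
  · have hterm : ∀ j ∈ s, c (d j) * (v.intResidue (m j) • v.leadingTermHom (L (ω j))) =
        v.leadingTerm (n j * L (ω j)) := by
      intro j hj
      obtain ⟨hm, hnj⟩ := hdm j hj
      change _ * ((v.intResidue (m j) : v.Gr) * v.leadingTerm (L (ω j))) = _
      rw [intResidue_coe_eq_leadingTerm _ hm, hc, ← leadingTerm_mul, ← leadingTerm_mul, ← mul_assoc,
        ← Int.cast_mul, ← hnj]
    have hsum : ∑ i ∈ s.image d, c i * ∑ j, (if j ∈ s ∧ d j = i then v.intResidue (m j) else 0) •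
        v.leadingTermHom (L (ω j)) = ∑ j ∈ s, v.leadingTerm (n j * L (ω j)) := by
      simp only [Finset.mul_sum]
      rw [Finset.sum_comm, ← Finset.sum_subset (Finset.subset_univ s)]
      · refine Finset.sum_congr rfl fun j hj => ?_
        rw [Finset.sum_eq_single (d j), if_pos ⟨hj, rfl⟩, hterm j hj]
        · intro i _ hi
          rw [if_neg fun h => hi h.2.symm, zero_smul, mul_zero]
        · intro h
          exact absurd (Finset.mem_image_of_mem d hj) h
      · intro j _ hj
        refine Finset.sum_eq_zero fun i _ => ?_
        rw [if_neg fun h => hj h.1, zero_smul, mul_zero]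
    -- All summands have degree `g`, so the sum of their leading terms is the class in `D_g` of
    -- their sum, which is zero when that sum has value above `g`.
    rw [hsum, ← Finset.sum_attach]
    rw [Finset.sum_congr rfl fun (j : s) _ => v.leadingTerm_eq_homog (hn j j.2), ← v.homog_sum,
      homog_eq_zero_iff]
    rw [AddSubmonoidClass.coe_finsetSum]
    exact hlt.trans_eq (congrArg v (Finset.sum_attach s fun j => (n j : D) * L (ω j)).symm)

-- Integers are central, so a word of length `l` acquires the factor `z ^ l`, which its integer
-- coefficient absorbs.
set_option linter.unusedSectionVars false in
theorem WordsIndependent.intCast_mul {ι : Type u} {y : ι → D} (hy : v.WordsIndependent y) (z : ℤ) :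
    v.WordsIndependent fun i => z * y i := by
  have hlift : ∀ w : FreeMonoid ι, FreeMonoid.lift (fun i => z * y i) w =
      ((z ^ w.length : ℤ) : D) * FreeMonoid.lift y w := by
    intro w
    induction w using FreeMonoid.inductionOn' with
    | one => simp
    | of_mul i w ih =>
      rw [_root_.map_mul, _root_.map_mul, ih, FreeMonoid.lift_eval_of, FreeMonoid.lift_eval_of,
        FreeMonoid.length_mul, FreeMonoid.length_of, pow_add, pow_one, Int.cast_mul, mul_assoc,
        ← mul_assoc (y i), ← (Int.cast_commute (z ^ w.length) (y i)).eq]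
      simp only [mul_assoc]
  intro J _ ω hω s hs n g hn hlt
  have e : ∀ j, (n j : D) * FreeMonoid.lift (fun i => z * y i) (ω j) =
      ((n j * z ^ (ω j).length : ℤ) : D) * FreeMonoid.lift y (ω j) := by
    intro j
    rw [hlift, ← mul_assoc, Int.cast_mul (n j)]
  simp only [e] at hn hlt
  exact hy J ω hω s hs _ g hn hlt

end GroupValuation

/-! ### Elements with the leading term of a word, and independence over `k` -/

namespace GroupValuation

variable {D : Type*} [DivisionRing D] {G : Type*} [AddGroup G] [LinearOrder G] [AddLeftMono G]
  [AddRightMono G] (v : GroupValuation D G)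

/-- The pairs `(w, b)` of a word `w` in the family `y` and an element `b` of `D` with the same
leading term as the value of `w`. -/
def perturbedWords {ι : Type*} (y : ι → D) : Submonoid (FreeMonoid ι × D) where
  carrier := {q | v (FreeMonoid.lift y q.1) < v (q.2 - FreeMonoid.lift y q.1)}
  one_mem' := by
    simp only [Set.mem_ofPred_eq, Prod.fst_one, Prod.snd_one, _root_.map_one, sub_self, v.map_zero,
      v.map_one]
    exact WithTop.coe_lt_top 0
  mul_mem' {p q} hp hq := by
    obtain ⟨w, b⟩ := p
    obtain ⟨w', b'⟩ := q
    simp only [Set.mem_ofPred_eq, Prod.mk_mul_mk, _root_.map_mul] at hp hq ⊢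
    set x := FreeMonoid.lift y w
    set x' := FreeMonoid.lift y w'
    obtain ⟨g, hg⟩ := WithTop.ne_top_iff_exists.1 (ne_top_of_lt hp)
    obtain ⟨h, hh⟩ := WithTop.ne_top_iff_exists.1 (ne_top_of_lt hq)
    rw [← hg] at hp
    rw [← hh] at hq
    rw [v.map_mul', ← hg, ← hh, ← WithTop.coe_add]
    have hx' : x' ∈ v.geSubgroup h := hh.le
    have hd' : b' - x' ∈ v.gtSubgroup h := hq
    have hb' : b' ∈ v.geSubgroup h := by
      have := (v.geSubgroup h).add_mem (show b' - x' ∈ v.geSubgroup h from hq.le) hx'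
      rwa [sub_add_cancel] at this
    have e : b * b' - x * x' = (b - x) * b' + x * (b' - x') := by noncomm_ring
    rw [e]
    exact (v.gtSubgroup (g + h)).add_mem (v.mul_mem_gt_left hp hb')
      (v.mul_mem_gt_right (show x ∈ v.geSubgroup g from hg.le) hd')

theorem mem_perturbedWords {ι : Type*} {y : ι → D} {w : FreeMonoid ι} {b : D} :
    (w, b) ∈ v.perturbedWords y ↔
      v (FreeMonoid.lift y w) < v (b - FreeMonoid.lift y w) := Iff.rfl

set_option linter.unusedSectionVars false in
theorem lift_ne_zero {ι : Type*} {y : ι → D} (hy : ∀ i, y i ≠ 0) (w : FreeMonoid ι) :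
    FreeMonoid.lift y w ≠ 0 := by
  induction w using FreeMonoid.inductionOn' with
  | one => simp
  | of_mul i w ih =>
    rw [_root_.map_mul, FreeMonoid.lift_eval_of]
    exact mul_ne_zero (hy i) ih

theorem lift_mem_perturbedWords {ι : Type*} {y : ι → D} (hy : ∀ i, y i ≠ 0) (w : FreeMonoid ι) :
    (w, FreeMonoid.lift y w) ∈ v.perturbedWords y := by
  rw [mem_perturbedWords, sub_self, v.map_zero]
  obtain ⟨g, hg⟩ := v.exists_eq_coe (lift_ne_zero hy w)
  rw [hg]
  exact WithTop.coe_lt_top g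

/-- Let `g` be the minimal value of the terms with nonzero coefficient. In a relation, the words of
value exactly `g` sum to minus the corrections `n j * (b j - L (ω j))` and the words of larger
value. All of these have value above `g`, against independence of words. -/
theorem intCast_eq_zero_of_sum_perturbedWords {ι : Type u} {y : ι → D}
    (hy : v.WordsIndependent y) {J : Type u} [Fintype J] {ω : J → FreeMonoid ι}
    {b : J → D} (hω : Function.Injective ω) (hb : ∀ j, (ω j, b j) ∈ v.perturbedWords y)
    {n : J → ℤ} (hn : ∑ j, (n j : D) * b j = 0) (j : J) : (n j : D) = 0 := by
  classical
  by_contra hj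
  set L := FreeMonoid.lift y
  set s₀ : Finset J := Finset.univ.filter fun j => (n j : D) ≠ 0
  obtain ⟨j₁, hj₁, hmin⟩ := Finset.exists_min_image s₀ (fun j => v (n j * L (ω j)))
    ⟨j, by simp [s₀, hj]⟩
  have hb' := fun j => v.mem_perturbedWords.1 (hb j)
  obtain ⟨a₁, ha₁⟩ := v.exists_eq_coe (Finset.mem_filter.1 hj₁).2
  obtain ⟨l₁, hl₁⟩ := WithTop.ne_top_iff_exists.1 (ne_top_of_lt (hb' j₁))
  have hg : v (n j₁ * L (ω j₁)) = ((a₁ + l₁ : G) : WithTop G) := by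
    rw [v.map_mul', ha₁, ← hl₁, WithTop.coe_add]
  set g := a₁ + l₁
  set s := s₀.filter fun j => v (n j * L (ω j)) = g
  refine hy J ω hω s ⟨j₁, Finset.mem_filter.2 ⟨hj₁, hg⟩⟩ n g
    (fun j h => (Finset.mem_filter.1 h).2) ?_
  have h0 : ∑ j ∈ s₀, (n j : D) * b j = 0 := by
    rw [← hn, Finset.sum_filter_of_ne]
    intro j _ h h'
    exact h (by rw [h', zero_mul])
  have e : ∑ j ∈ s, (n j : D) * L (ω j) = -(∑ j ∈ s₀, (n j : D) * (b j - L (ω j)) +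
      ∑ j ∈ s₀.filter (fun j => ¬ v (n j * L (ω j)) = g), (n j : D) * L (ω j)) := by
    simp only [mul_sub, Finset.sum_sub_distrib]
    rw [h0, ← Finset.sum_filter_add_sum_filter_not s₀ (fun j => v (n j * L (ω j)) = g)]
    abel
  change _ ∈ v.gtSubgroup g
  rw [e]
  refine (v.gtSubgroup g).neg_mem ((v.gtSubgroup g).add_mem (AddSubgroup.sum_mem _ fun j hj => ?_)
    (AddSubgroup.sum_mem _ fun j hj => ?_))
  · have hle := hmin j hj
    obtain ⟨a, ha⟩ := v.exists_eq_coe (Finset.mem_filter.1 hj).2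
    obtain ⟨l, hl⟩ := WithTop.ne_top_iff_exists.1 (ne_top_of_lt (hb' j))
    rw [hg, v.map_mul', ha, ← hl, ← WithTop.coe_add] at hle
    have h := v.mul_mem_gt_right (g := a) (h := l) (x := n j) (y := b j - L (ω j)) ha.ge
      (show (l : WithTop G) < _ by rw [hl]; exact hb' j)
    exact hle.trans_lt h
  · obtain ⟨hj, hne⟩ := Finset.mem_filter.1 hj
    have hle := hmin j hj
    rw [hg] at hle
    exact lt_of_le_of_ne hle (Ne.symm hne)

theorem exists_common_denominator {k J : Type*} [Field k] [Fintype J] (q : J → (⊥ : Subfield k)) :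
    ∃ N : ℤ, (N : k) ≠ 0 ∧ ∀ j, ∃ n : ℤ, (N : k) * q j = n := by
  classical
  have h : ∀ j, ∃ a d : ℤ, (d : k) ≠ 0 ∧ (d : k) * q j = a := by
    intro j
    have hq : (q j : k) ∈ Subfield.closure (∅ : Set k) := by
      rw [Subfield.closure_empty]
      exact (q j).2
    obtain ⟨x, hx, z, hz, e⟩ := Subfield.mem_closure_iff.1 hq
    rw [Subring.closure_empty, Subring.mem_bot] at hx hz
    obtain ⟨a, rfl⟩ := hx
    obtain ⟨d, rfl⟩ := hz
    -- Membership in the subfield closure allows the denominator `0`; the quotient is then `0`.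
    by_cases hd : (d : k) = 0
    · exact ⟨0, 1, by simp, by rw [← e, hd]; simp⟩
    · exact ⟨a, d, hd, by rw [← e, mul_div_cancel₀ _ hd]⟩
  choose a d hd hda using h
  refine ⟨∏ j, d j, by rw [Int.cast_prod]; exact Finset.prod_ne_zero_iff.2 fun j _ => hd j,
    fun j => ⟨(∏ l ∈ Finset.univ.erase j, d l) * a j, ?_⟩⟩
  rw [← Finset.mul_prod_erase Finset.univ d (Finset.mem_univ j), Int.cast_mul, Int.cast_mul, ← hda]
  ring

variable {k : Type*} [Field k] [Algebra k D]

theorem linearIndependent_bot_perturbedWords {ι : Type u} {y : ι → D}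
    (hy : v.WordsIndependent y) {J : Type u} [Fintype J] {ω : J → FreeMonoid ι}
    {b : J → D} (hω : Function.Injective ω) (hb : ∀ j, (ω j, b j) ∈ v.perturbedWords y) :
    LinearIndependent (⊥ : Subfield k) b := by
  rw [Fintype.linearIndependent_iff]
  intro q hq j
  obtain ⟨N, hN, hn⟩ := exists_common_denominator q
  choose n hn using hn
  have hsmul : ∀ j, (n j : D) * b j = (N : k) • (q j • b j) := by
    intro j
    rw [show q j • b j = (q j : k) • b j from rfl, smul_smul, hn, Algebra.smul_def,
      _root_.map_intCast]
  have h0 := v.intCast_eq_zero_of_sum_perturbedWords hy hω hb (n := n) (by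
    simp only [hsmul]
    rw [← Finset.smul_sum, hq, smul_zero]) j
  have h1 : (n j : k) = 0 := by
    apply (algebraMap k D).injective
    rw [_root_.map_intCast, h0, _root_.map_zero]
  rw [← hn] at h1
  exact Subtype.ext ((mul_eq_zero.1 h1).resolve_left hN)

/-- The coefficients of a relation are expanded in a maximal subfamily of them independent over the
prime field. Those basis elements serve as the central `c_i`, and the coordinates, which lie in the
prime field, as `α`. -/
theorem linearIndependent_perturbedWords {ι : Type u} (hι : IsEmpty ι ∨ Nontrivial ι) {y : ι → D}
    (hy : v.WordsIndependent y) (hy0 : ∀ i, y i ≠ 0) {J : Type u} [Fintype J] {ω : J → FreeMonoid ι}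
    {b : J → D} (hω : Function.Injective ω) (hb : ∀ j, (ω j, b j) ∈ v.perturbedWords y) :
    LinearIndependent k b := by
  classical
  rw [Fintype.linearIndependent_iff]
  intro c hc
  by_contra! hne
  obtain ⟨j₀, hj₀⟩ := hne
  obtain ⟨κ, a, ha, hspan, hli⟩ := exists_linearIndependent' (⊥ : Subfield k) c
  have : Finite κ := Finite.of_injective a ha
  have := Fintype.ofFinite κ
  let B := Module.Basis.span hli
  have hmem : ∀ j, c j ∈ Submodule.span (⊥ : Subfield k) (Set.range (c ∘ a)) := fun j => by
    rw [hspan]; exact Submodule.subset_span ⟨j, rfl⟩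
  have hcj : ∀ j, c j = ∑ i, (B.repr ⟨c j, hmem j⟩ i : k) * c (a i) := by
    intro j
    have := congrArg Subtype.val (B.sum_repr ⟨c j, hmem j⟩)
    rw [AddSubmonoidClass.coe_finsetSum] at this
    simp only [B, SetLike.val_smul, Module.Basis.span_apply] at this
    exact this.symm
  -- The basis is chosen among the coefficients themselves, so its members have unit coordinate
  -- vectors; this is the echelon form.
  have hpiv : ∀ i l, B.repr ⟨c (a i), hmem (a i)⟩ l = if i = l then 1 else 0 := by
    intro i l
    rw [show (⟨c (a i), hmem (a i)⟩ : Submodule.span (⊥ : Subfield k) (Set.range (c ∘ a))) = B i from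
      (Module.Basis.span_apply hli i).symm, B.repr_self, Finsupp.single_apply]
  have hκ : Nonempty κ := by
    by_contra h
    rw [not_nonempty_iff] at h
    exact hj₀ (by rw [hcj, Finset.univ_eq_empty, Finset.sum_empty])
  have hreg : ∀ i, algebraMap k D (c (a i)) ≠ 0 := fun i h =>
    hli.ne_zero i ((algebraMap k D).injective (by rw [_root_.map_zero]; exact h))
  refine central_combination_ne_zero (Z := (⊥ : Subfield k)) hι (v.perturbedWords y)
    (fun w => ⟨_, v.lift_mem_perturbedWords hy0 w⟩)
    (fun J' _ ω' b' hω' hb' => v.linearIndependent_bot_perturbedWords hy hω' hb')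
    (fun i : κ => algebraMap k D (c (a i))) (fun i r => Algebra.commutes _ r)
    (fun i r h => (mul_eq_zero.1 h).resolve_left (hreg i)) (Fintype.card κ - 1) Finset.univ
    (by rw [Finset.card_univ]; have := Fintype.card_pos (α := κ); omega) J ω b hω hb
    (fun i j => B.repr ⟨c j, hmem j⟩ i) a ?_ ?_ ?_
  · intro i _
    rw [hpiv, if_pos rfl]
    exact one_ne_zero
  · intro i _ l _ hil
    rw [hpiv, if_neg hil]
  · rw [← hc]
    simp only [Finset.mul_sum]
    rw [Finset.sum_comm]
    refine Finset.sum_congr rfl fun j _ => ?_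
    conv_rhs => rw [hcj j, Finset.sum_smul]
    refine Finset.sum_congr rfl fun i _ => ?_
    rw [← Algebra.smul_def, mul_comm, mul_smul]
    rfl

end GroupValuation

/-! ### Encoding reduced group words by monoid words -/

/-- The word attached to a list of letters `x`, `x⁻¹`: each run `x ^ m` contributes `x ^ (2 * m)`
and each run `x ^ (-m)` contributes `x ^ (2 * m - 1)`. -/
def FreeGroup.blockWord {ι : Type*} [DecidableEq ι] : List (ι × Bool) → List ι
  | [] => []
  | (x, e) :: L =>
    if e = true ∨ L.head? = some (x, false) then x :: x :: blockWord L else x :: blockWord L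

/-- The product of the factors `y² (1 + y)⁻¹` and `y (1 + y)⁻¹` that correspond to the factors `x²`
and `x` of `FreeGroup.blockWord`. -/
def FreeGroup.blockElement {ι D : Type*} [DecidableEq ι] [DivisionRing D] (y : ι → D) :
    List (ι × Bool) → D
  | [] => 1
  | (x, e) :: L =>
    (if e = true ∨ L.head? = some (x, false) then y x * y x * (1 + y x)⁻¹
      else y x * (1 + y x)⁻¹) * blockElement y L

namespace FreeGroup

variable {ι : Type*} [DecidableEq ι]

theorem blockWord_cons (x : ι) (e : Bool) (L : List (ι × Bool)) :
    ∃ W, blockWord ((x, e) :: L) = x :: W := by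
  rw [blockWord]
  split_ifs
  exacts [⟨_, rfl⟩, ⟨_, rfl⟩]

theorem IsReduced.blockWord_ne_cons {x : ι} {L : List (ι × Bool)}
    (hL : IsReduced ((x, false) :: L)) (h : L.head? ≠ some (x, false)) (W : List ι) :
    blockWord L ≠ x :: W := by
  rcases L with _ | ⟨⟨x', e⟩, L⟩
  · simp [blockWord]
  · intro hW
    obtain ⟨W', hW'⟩ := blockWord_cons x' e L
    rw [hW', List.cons.injEq] at hW
    obtain ⟨rfl, -⟩ := hW
    have := (List.isChain_cons_cons.1 hL).1 rfl
    simp only at this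
    subst this
    exact h rfl

/-- Neighbouring runs of a reduced word involve different letters, so runs of the block word
correspond to runs of the group word, and the parity of a run's length gives the sign of the
exponent. -/
theorem IsReduced.blockWord_injective {L L' : List (ι × Bool)} (hL : IsReduced L)
    (hL' : IsReduced L') (h : blockWord L = blockWord L') : L = L' := by
  induction L generalizing L' with
  | nil =>
    rcases L' with _ | ⟨⟨x, e⟩, L'⟩
    · rfl
    · obtain ⟨W, hW⟩ := blockWord_cons x e L'
      rw [hW, blockWord] at h
      cases h
  | cons p L ih =>
    obtain ⟨x, e⟩ := p
    rcases L' with _ | ⟨⟨x', e'⟩, L'⟩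
    · obtain ⟨W, hW⟩ := blockWord_cons x e L
      rw [hW, blockWord] at h
      cases h
    have hx : x = x' := by
      obtain ⟨W, hW⟩ := blockWord_cons x e L
      obtain ⟨W', hW'⟩ := blockWord_cons x' e' L'
      rw [hW, hW'] at h
      exact (List.cons.inj h).1
    subst hx
    have hrL : IsReduced L := List.IsChain.tail hL
    have hrL' : IsReduced L' := List.IsChain.tail hL'
    -- When both heads are doubled the tails agree. This excludes opposite signs, since a doubled
    -- `x⁻¹` is followed by `x⁻¹` and `x` cannot be.
    have hmix : ∀ {M : List (ι × Bool)}, IsReduced ((x, true) :: M) →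
        M.head? ≠ some (x, false) := by
      rintro (_ | ⟨q, M⟩) hM hq
      · cases hq
      · simp only [List.head?_cons, Option.some.injEq] at hq
        subst hq
        exact absurd ((List.isChain_cons_cons.1 hM).1 rfl) (by simp)
    rw [blockWord, blockWord] at h
    split_ifs at h with h1 h2 h2
    · simp only [List.cons.injEq, true_and] at h
      obtain rfl := ih hrL hrL' h
      cases e <;> cases e'
      · rfl
      · exact absurd (h1.resolve_left (by simp)) (hmix hL')
      · exact absurd (h2.resolve_left (by simp)) (hmix hL)
      · rfl
    · simp only [List.cons.injEq, true_and] at h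
      push Not at h2
      obtain rfl : e' = false := by simpa using h2.1
      exact absurd h.symm (hL'.blockWord_ne_cons h2.2 _)
    · simp only [List.cons.injEq, true_and] at h
      push Not at h1
      obtain rfl : e = false := by simpa using h1.1
      exact absurd h (hL.blockWord_ne_cons h1.2 _)
    · simp only [List.cons.injEq, true_and] at h
      obtain rfl := ih hrL hrL' h
      push Not at h1 h2
      obtain rfl : e = false := by simpa using h1.1
      obtain rfl : e' = false := by simpa using h2.1
      rfl

open scoped Pointwise

/-- The letters `x`, `x⁻¹` with `x` in `X`, together with `1`. -/
def letters (X : Finset ι) : Finset (FreeGroup ι) :=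
  insert 1 ((X ×ˢ (Finset.univ : Finset Bool)).image fun p => mk [p])

theorem mk_mem_letters {X : Finset ι} {p : ι × Bool} (hp : p.1 ∈ X) : mk [p] ∈ letters X :=
  Finset.mem_insert_of_mem (Finset.mem_image_of_mem _ (by simp [hp]))

theorem one_mem_letters (X : Finset ι) : 1 ∈ letters X := Finset.mem_insert_self _ _

theorem mk_mem_letters_pow {X : Finset ι} {L : List (ι × Bool)} (hL : ∀ p ∈ L, p.1 ∈ X) {n : ℕ}
    (hn : L.length ≤ n) : mk L ∈ letters X ^ n := by
  refine Finset.pow_subset_pow_right (one_mem_letters X) hn ?_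
  clear hn
  induction L with
  | nil => simp [← one_eq_mk]
  | cons p L ih =>
    rw [List.length_cons, pow_succ', show mk (p :: L) = mk [p] * mk L from rfl]
    exact Finset.mul_mem_mul (mk_mem_letters (hL p (by simp)))
      (ih fun q hq => hL q (List.mem_cons_of_mem _ hq))

/-- Reduction only deletes letters. With `mk_mem_letters_pow`, this identifies `letters X ^ n` with
the ball of radius `n` on the letters of `X`. -/
theorem toWord_of_mem_letters_pow {X : Finset ι} {n : ℕ} {g : FreeGroup ι}
    (hg : g ∈ letters X ^ n) : g.toWord.length ≤ n ∧ ∀ p ∈ g.toWord, p.1 ∈ X := by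
  obtain ⟨L, rfl, hn, hL⟩ : ∃ L, mk L = g ∧ L.length ≤ n ∧ ∀ p ∈ L, p.1 ∈ X := by
    induction n generalizing g with
    | zero =>
      rw [pow_zero, Finset.mem_one] at hg
      exact ⟨[], hg.symm, by simp, by simp⟩
    | succ n ih =>
      rw [pow_succ', Finset.mem_mul] at hg
      obtain ⟨a, ha, b, hb, rfl⟩ := hg
      obtain ⟨L, rfl, hn, hL⟩ := ih hb
      rcases Finset.mem_insert.1 ha with rfl | ha
      · exact ⟨L, (one_mul _).symm, by omega, hL⟩
      · obtain ⟨p, hp, rfl⟩ := Finset.mem_image.1 ha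
        refine ⟨p :: L, rfl, by simpa using hn, ?_⟩
        intro q hq
        rcases List.mem_cons.1 hq with rfl | hq
        · exact (Finset.mem_product.1 hp).1
        · exact hL q hq
  have hsub : (mk L).toWord.Sublist L := by
    rw [toWord_mk]
    exact reduce.red.sublist
  exact ⟨hsub.length_le.trans hn, fun p hp => hL p (hsub.subset hp)⟩

/-- Each factor is a combination of `1`, `1 + y x` and `(1 + y x)⁻¹`, and a word of length at most
`n` has at most `n` factors. -/
theorem blockElement_mem_span {k D : Type*} [Field k] [DivisionRing D] [Algebra k D] {y : ι → D}
    (hy : ∀ i, 1 + y i ≠ 0) {φ : FreeGroup ι →* D} (hφ : ∀ i, φ (of i) = 1 + y i) {X : Finset ι}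
    {L : List (ι × Bool)} (hL : ∀ p ∈ L, p.1 ∈ X) {n : ℕ} (hn : L.length ≤ n) :
    blockElement y L ∈ Submodule.span k (φ '' (letters X ^ n : Finset (FreeGroup ι))) := by
  induction L generalizing n with
  | nil =>
    refine Submodule.subset_span ⟨1, ?_, φ.map_one⟩
    exact mk_mem_letters_pow (L := []) hL hn
  | cons p L ih =>
    obtain ⟨x, e⟩ := p
    obtain ⟨n, rfl⟩ : ∃ m, n = m + 1 := ⟨n - 1, by rw [List.length_cons] at hn; omega⟩
    have hx : x ∈ X := hL (x, e) (by simp)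
    have h2 := ih (n := n) (fun q hq => hL q (List.mem_cons_of_mem _ hq)) (by simpa using hn)
    rw [pow_succ', Finset.coe_mul, Set.image_mul, ← Submodule.span_mul_span, blockElement]
    refine Submodule.mul_mem_mul ?_ h2
    set V := Submodule.span k (φ '' (letters X : Finset (FreeGroup ι)))
    have hV1 : (1 : D) ∈ V := Submodule.subset_span ⟨1, one_mem_letters X, φ.map_one⟩
    have hVx : 1 + y x ∈ V :=
      Submodule.subset_span ⟨of x, mk_mem_letters (p := (x, true)) hx, hφ x⟩
    have hVi : (1 + y x)⁻¹ ∈ V := by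
      refine Submodule.subset_span ⟨(of x)⁻¹, mk_mem_letters (p := (x, false)) hx, ?_⟩
      refine eq_inv_of_mul_eq_one_left ?_
      rw [← hφ, ← _root_.map_mul, inv_mul_cancel, _root_.map_one]
    have hu : y x = (1 + y x) - 1 := by abel
    split_ifs
    · have : y x * y x * (1 + y x)⁻¹ = (1 + y x) - 1 - 1 + (1 + y x)⁻¹ := by
        have h3 : y x * y x = ((1 + y x) - 1 - 1) * (1 + y x) + 1 := by noncomm_ring
        rw [h3, add_mul, mul_assoc, mul_inv_cancel₀ (hy x), mul_one, one_mul]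
      rw [this]
      exact V.add_mem (V.sub_mem (V.sub_mem hVx hV1) hV1) hVi
    · have : y x * (1 + y x)⁻¹ = 1 - (1 + y x)⁻¹ := by
        nth_rewrite 1 [hu]
        rw [sub_mul, mul_inv_cancel₀ (hy x), one_mul]
      rw [this]
      exact V.sub_mem hV1 hVi

end FreeGroup

/-! ### Independence of the free group in `D` -/

namespace GroupValuation

variable {D : Type*} [DivisionRing D] {G : Type*} [AddGroup G] [LinearOrder G] [AddLeftMono G]
  [AddRightMono G] (v : GroupValuation D G)

theorem map_one_add {x : D} (hx : 0 < v x) : v (1 + x) = 0 := by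
  refine le_antisymm ?_ ((le_min v.map_one.ge hx.le).trans (v.min_le_add' 1 x))
  by_contra! h
  have h1 := v.min_le_add' (1 + x) (-x)
  rw [add_neg_cancel_right, v.map_one, v.map_neg] at h1
  exact absurd h1 (not_le.2 (lt_min h hx))

/-- As `v (y i) > 0`, the inverse `(1 + y i)⁻¹ = 1 - y i * (1 + y i)⁻¹` has leading term `1`, so
each factor has the leading term of `y i * y i` or `y i`. -/
theorem blockElement_mem_perturbedWords {ι : Type*} [DecidableEq ι] {y : ι → D}
    (hy0 : ∀ i, y i ≠ 0) (hy : ∀ i, 0 < v (y i)) (L : List (ι × Bool)) :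
    (FreeMonoid.ofList (FreeGroup.blockWord L), FreeGroup.blockElement y L) ∈
      v.perturbedWords y := by
  have hof : ∀ i, (FreeMonoid.of i, y i) ∈ v.perturbedWords y := fun i => by
    simpa using v.lift_mem_perturbedWords hy0 (FreeMonoid.of i)
  have hinv : ∀ i, ((1 : FreeMonoid ι), (1 + y i)⁻¹) ∈ v.perturbedWords y := fun i => by
    have h1 := v.map_one_add (hy i)
    have h2 := v.ne_zero_of_map_eq_zero h1
    have h3 : v (1 + y i)⁻¹ = 0 := by
      have := v.map_mul' (1 + y i) (1 + y i)⁻¹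
      rw [mul_inv_cancel₀ h2, v.map_one, h1, zero_add] at this
      exact this.symm
    rw [mem_perturbedWords, _root_.map_one, v.map_one]
    have h4 : (1 + y i)⁻¹ - 1 = -(y i * (1 + y i)⁻¹) := by
      have : y i = (1 + y i) - 1 := by abel
      nth_rewrite 2 [this]
      rw [sub_mul, mul_inv_cancel₀ h2, one_mul, neg_sub]
    rw [h4, v.map_neg, v.map_mul', h3, add_zero]
    exact hy i
  induction L with
  | nil => exact (v.perturbedWords y).one_mem
  | cons p L ih =>
    obtain ⟨x, e⟩ := p
    rw [FreeGroup.blockWord, FreeGroup.blockElement]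
    split_ifs
    · exact (v.perturbedWords y).mul_mem ((v.perturbedWords y).mul_mem
        ((v.perturbedWords y).mul_mem (hof x) (hof x)) (hinv x)) ih
    · exact (v.perturbedWords y).mul_mem ((v.perturbedWords y).mul_mem (hof x) (hinv x)) ih

variable {k : Type*} [Field k] [Algebra k D]

-- A finite subset of the group lies in a ball `A`. The span of `φ A` contains the `|A|` independent
-- block elements of the members of `A`, so its dimension is at least `|A|` and the family `φ` on
-- `A` is independent.
open scoped Pointwise in
theorem linearIndependent_freeGroup {ι : Type u} (hι : IsEmpty ι ∨ Nontrivial ι) {y : ι → D}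
    (hw : v.WordsIndependent y) (hy0 : ∀ i, y i ≠ 0) (hy : ∀ i, 0 < v (y i))
    {φ : FreeGroup ι →* D} (hφ : ∀ i, φ (FreeGroup.of i) = 1 + y i) : LinearIndependent k φ := by
  classical
  rw [linearIndependent_iff_finset_linearIndependent]
  intro s
  set X : Finset ι := s.biUnion fun g => (g.toWord.map Prod.fst).toFinset
  set n := s.sup FreeGroup.norm
  have hs : s ⊆ FreeGroup.letters X ^ n := by
    intro g hg
    rw [← FreeGroup.mk_toWord (x := g)]
    refine FreeGroup.mk_mem_letters_pow (fun p hp => ?_) (Finset.le_sup (f := FreeGroup.norm) hg)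
    exact Finset.mem_biUnion.2 ⟨g, hg, List.mem_toFinset.2 (List.mem_map_of_mem hp)⟩
  have hne : ∀ i, 1 + y i ≠ 0 := fun i => v.ne_zero_of_map_eq_zero (v.map_one_add (hy i))
  set A := FreeGroup.letters X ^ n
  have hblock : LinearIndependent k fun g : A => FreeGroup.blockElement y (g : FreeGroup ι).toWord := by
    refine v.linearIndependent_perturbedWords hι hw hy0
      (ω := fun g : A => FreeMonoid.ofList (FreeGroup.blockWord (g : FreeGroup ι).toWord))
      (fun g h hgh => ?_) fun g => v.blockElement_mem_perturbedWords hy0 hy _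
    exact Subtype.ext (FreeGroup.toWord_injective (FreeGroup.isReduced_toWord.blockWord_injective
      FreeGroup.isReduced_toWord (FreeMonoid.ofList.injective hgh)))
  have hA : LinearIndependent k fun g : A => φ g := by
    rw [linearIndependent_iff_card_le_finrank_span, ← finrank_span_eq_card hblock]
    have := FiniteDimensional.span_of_finite k (Set.finite_range fun g : A => φ g)
    refine Submodule.finrank_mono (Submodule.span_le.2 ?_)
    rintro _ ⟨g, rfl⟩
    obtain ⟨hlen, hlet⟩ := FreeGroup.toWord_of_mem_letters_pow g.2
    have := FreeGroup.blockElement_mem_span (k := k) hne hφ hlet hlen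
    rwa [Set.image_eq_range] at this
  exact hA.comp (Set.inclusion hs) (Set.inclusion_injective hs)

end GroupValuation

/-! ### From linear independence to the free group algebra -/

theorem generatesFreeGroupAlgebra_of_linearIndependent {k D : Type*} [Field k] [DivisionRing D]
    [Algebra k D] {S : Set D} {φ : FreeGroup S →* D} (hφ : ∀ s, φ (FreeGroup.of s) = s)
    (hli : LinearIndependent k φ) : GeneratesFreeGroupAlgebra k S := by
  set F := MonoidAlgebra.lift k D (FreeGroup S) φ
  have hFof : ∀ g, F (MonoidAlgebra.of k _ g) = φ g := fun g => MonoidAlgebra.lift_of φ g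
  have hinv : ∀ s : S, φ (FreeGroup.of s)⁻¹ = (s : D)⁻¹ := fun s => by
    refine eq_inv_of_mul_eq_one_left ?_
    rw [← hφ, ← map_mul, inv_mul_cancel, map_one]
  have hF : Function.Injective F := by
    rw [injective_iff_map_eq_zero]
    intro a ha
    have h := linearIndependent_iff.1 hli a.coeff (by
      rw [← ha, MonoidAlgebra.lift_apply, Finsupp.linearCombination_apply])
    exact MonoidAlgebra.coeff_injective h
  have hrange : F.range = Algebra.adjoin k (S ∪ (fun s => s⁻¹) '' S) := by
    refine le_antisymm ?_ (Algebra.adjoin_le ?_)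
    · rintro _ ⟨a, rfl⟩
      have hmem : ∀ g, φ g ∈ Algebra.adjoin k (S ∪ (fun s => s⁻¹) '' S) := by
        intro g
        induction g using FreeGroup.induction_on with
        | C1 => rw [map_one]; exact one_mem _
        | of s => rw [hφ]; exact Algebra.subset_adjoin (Or.inl s.2)
        | inv_of s _ => rw [hinv]; exact Algebra.subset_adjoin (Or.inr ⟨s, s.2, rfl⟩)
        | mul g h hg hh => rw [map_mul]; exact mul_mem hg hh
      change F a ∈ _
      rw [MonoidAlgebra.lift_apply]
      exact Subalgebra.sum_mem _ fun g _ => Subalgebra.smul_mem _ (hmem g) _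
    · rintro _ (hs | ⟨s, hs, rfl⟩)
      · exact ⟨_, (hFof _).trans (hφ ⟨_, hs⟩)⟩
      · exact ⟨_, (hFof _).trans (hinv ⟨s, hs⟩)⟩
  refine ⟨(AlgEquiv.ofInjective F hF).trans (Subalgebra.equivOfEq _ _ hrange), fun s => ?_⟩
  exact (hFof _).trans (hφ s)

namespace GroupValuation

variable {D : Type*} [DivisionRing D] {G : Type*} [AddGroup G] [LinearOrder G] [AddLeftMono G]
  [AddRightMono G] (v : GroupValuation D G) {k : Type*} [Field k] [Algebra k D]

set_option linter.unusedSectionVars false in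
theorem WordsIndependent.comp {ι κ : Type u} {y : ι → D} (hy : v.WordsIndependent y) {f : κ → ι}
    (hf : Function.Injective f) : v.WordsIndependent (y ∘ f) := by
  have hlift : ∀ w, FreeMonoid.lift (y ∘ f) w = FreeMonoid.lift y (FreeMonoid.map f w) := by
    intro w
    induction w using FreeMonoid.inductionOn' with
    | one => simp
    | of_mul i w ih => simp [ih]
  intro J _ ω hω
  simp only [hlift]
  exact hy J (fun j => FreeMonoid.map f (ω j)) fun a b hab => hω (List.map_injective_iff.2 hf hab)

/-- If the words in a family `y` of elements of positive value have independent leading terms, then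
the elements `1 + y x` generate a free group algebra. -/
theorem WordsIndependent.generatesFreeGroupAlgebra {X : Set D} (hX : IsEmpty X ∨ Nontrivial X)
    {y : D → D} (hinj : Function.Injective y) (hw : v.WordsIndependent fun x : X => y x)
    (hy : ∀ x ∈ X, 0 < v (y x)) (hy0 : ∀ x ∈ X, y x ≠ 0) :
    GeneratesFreeGroupAlgebra k ((fun x => 1 + y x) '' X) := by
  let E : X ≃ (fun x => 1 + y x) '' X :=
    Equiv.Set.image _ X fun a b h => hinj (add_left_cancel h)
  have hE : ∀ s, 1 + y (E.symm s) = (s : D) := fun s =>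
    congrArg Subtype.val (E.apply_symm_apply s)
  have hne : ∀ s : (fun x => 1 + y x) '' X, (s : D) ≠ 0 := fun s => by
    rw [← hE]
    exact v.ne_zero_of_map_eq_zero (v.map_one_add (hy _ (E.symm s).2))
  refine generatesFreeGroupAlgebra_of_linearIndependent
    (φ := (Units.coeHom D).comp (FreeGroup.lift fun s => Units.mk0 (s : D) (hne s)))
    (fun s => by simp) ?_
  refine v.linearIndependent_freeGroup (y := (fun x : X => y x) ∘ E.symm)
    (hX.imp E.isEmpty_congr.1 E.nontrivial_congr.1)
    (hw.comp v E.symm.injective) (fun s => hy0 _ (E.symm s).2) (fun s => hy _ (E.symm s).2) ?_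
  intro s
  simp [hE]

end GroupValuation

theorem theorem4p1 {D : Type*} [DivisionRing D]
    {G : Type*} [AddGroup G] [LinearOrder G] [AddLeftMono G] [AddRightMono G]
    (v : GroupValuation D G) (hv : v.IsNontrivial)
    (X : Set D) (hX : ∀ x : D, X ≠ {x})
    (h1 : Set.InjOn v.leadingTerm X)
    (h2 : ∀ x ∈ X, 0 < v x)
    (h3 : ∀ x ∈ X, ∀ y ∈ X, v.ValueArchEquiv x y)
    (h4 : GeneratesFreeAlgebra v.Z0 (v.leadingTerm '' X))
    {k : Type*} [Field k] [Algebra k D] :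
    ((¬ ∃ z ∈ (⊥ : Subring D), ∀ x ∈ X, v.ValueLL x z) →
      GeneratesFreeGroupAlgebra k ((fun x => 1 + x) '' X)) ∧
    (∀ z ∈ (⊥ : Subring D), (∀ x ∈ X, v.ValueLL x z) →
      GeneratesFreeGroupAlgebra k ((fun x => 1 + z * x) '' X)) := by
  have hX' : IsEmpty X ∨ Nontrivial X := by
    rcases X.eq_empty_or_nonempty with rfl | ⟨x, hx⟩
    · exact Or.inl inferInstance
    · right
      rw [Set.nontrivial_coe_sort]
      by_contra h
      exact hX x ((Set.not_nontrivial_iff.1 h).eq_singleton_of_mem hx)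
  have h0 : ∀ x ∈ X, x ≠ 0 := by
    rintro x hx rfl
    obtain ⟨g, -, hg, -⟩ := h3 0 hx 0 hx
    rw [v.map_zero] at hg
    exact WithTop.top_ne_coe hg
  have hw := v.wordsIndependent_of_generatesFreeAlgebra hX' h1 h4
  refine ⟨fun _ => hw.generatesFreeGroupAlgebra v hX' (y := id) Function.injective_id h2 h0, ?_⟩
  intro z hz hll
  -- For empty `X` the condition on `z` is vacuous and `z` may be `0`; an element of `X` is what
  -- makes `z` nonzero and multiplication by it injective.
  rcases X.eq_empty_or_nonempty with rfl | ⟨x, hx⟩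
  · have := hw.generatesFreeGroupAlgebra (k := k) v hX' (y := id) Function.injective_id h2 h0
    rwa [Set.image_empty] at this ⊢
  obtain ⟨n, rfl⟩ := Subring.mem_bot.1 hz
  have hn : (n : D) ≠ 0 := by
    intro h
    obtain ⟨-, g, -, hg, -⟩ := hll x hx
    rw [h, v.map_zero] at hg
    exact WithTop.top_ne_coe hg
  refine (hw.intCast_mul v n).generatesFreeGroupAlgebra v hX' (y := fun x => n * x)
    (mul_right_injective₀ hn) (fun x hx => ?_) fun x hx => mul_ne_zero hn (h0 x hx)
  rw [v.map_mul']
  exact (h2 x hx).trans_le (le_add_of_nonneg_left (v.intCast_nonneg n))
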